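/- Let $(\Omega,\mathcal F,(\mathcal F_t)_{t\ge 0},\mathbb P)$ be a filtered probability space and write $L^2(\mathcal A)=L^2(\Omega,\mathcal A,\mathbb P;\mathbb R)$ for a sub-$\sigma$-algebra $\mathcal A\subseteq\mathcal F$. **Risk-perspective.** A proper convex risk-measure is a function $\rho:L^2(\mathcal F)\to(-\infty,\infty]$ that is finite somewhere, decreasing ($X\le Y$ a.s. $\Rightarrow\rho(X)\ge\rho(Y)$), cash-invariant ($\rho(X+k)=\rho(X)-k$ for $k\in\mathbb R$) and convex. Its acceptance set is $\mathscr A_\rho=\{Z\in L^2(\mathcal F):\rho(Z)\le 0\}$. A risk-perspective is a quintuple $\mathcal R=(\mathcal G,\rho,U,\Phi,M)$ where $\mathcal G\subseteq\mathcal F$ is a $\sigma$-algebra; $\rho$ is a proper convex risk-measure with $\mathscr A_\rho$ non-empty and closed; $U:L^2(\mathcal F)\to L^2(\mathcal G)$ is such that $\rho\circ U$ is proper, convex, lower semi-continuous and $\inf_{L^2(\mathcal G)}\rho\circ U>-\infty$; $\Phi\subseteq L^2(\mathcal F)$ is non-empty, convex and closed with $L^2(\mathcal G)\cap\Phi\cap\mathscr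 A_\rho\cap\{\rho\circ U<\infty\}\ne\emptyset$; and $M\in(0,\infty]$. For $\lambda\in[0,1)$ and $X\in L^2(\mathcal F)$ put $$\mathcal R^\lambda(X)=\operatorname*{argmin}_{Z\in L^2(\mathcal G)\cap\Phi}\ (1-\lambda)\,\mathbb E[|X-Z|^2]+\lambda\,\rho(U(X-Z)).$$ **Setting.** Let $\rho$ be lower semi-continuous, $m\ge0$, and $g:\mathbb R\to\mathbb R$ continuous with $Z\mapsto\rho(g(Z))$ convex on $L^2(\mathcal F)$ (with $\rho(g(Z))=\infty$ if $g(Z)\notin L^2$), and suppose $\Phi=\{Z\in L^2(\mathcal F):\rho(g(Z))\le m\}$. Call $\kappa>0$ a *multiplier at $X$* if (at $\lambda=0$) $$\operatorname*{argmin}_{Z\in L^2(\mathcal G)\cap\Phi}\mathbb E[|X-Z|^2]=\operatorname*{argmin}_{Z\in L^2(\mathcal G)}\mathbb E[|X-Z|^2]+\kappa\big(\rho(g(Z))-m\big)=\operatorname*{argmin}_{Z\in L^2(\mathcal G)}\mathbb E[|X-Z|^2]+\kappa\,\rho(g(Z)).$$ For $X\in L^2(\mathcal F)$ let $\mathcal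 M^t_{alt}(X)=\{YX: Y\in L^2(\mathcal F_t)\}\subseteq L^1$ be the set of alternative models of $X$. For $\alpha:L^2(\mathcal F)\to(-\infty,\infty]$ put $$\mathcal V_{\alpha}(X)=\sup_{\tilde X\in\mathcal M^t_{alt}(X)}\ \mathbb E[\tilde X]-\alpha\big(\tilde X/X\big),$$ where, if $X$ vanishes with positive probability, the supremum also runs over all $Z\in L^2(\mathcal F_t)$ with $\tilde X=ZX$ in the place of $\tilde X/X$. With ${}^\star$ the convex conjugate on $L^2(\mathcal F)$, $\iota_C$ the indicator function ($0$ on $C$, $\infty$ off $C$) and $\sigma_C(Z)=\sup_{Y\in C}\mathbb E[ZY]$, put $$\alpha_\eta=\Big(\tfrac1{2\eta}\mathbb E[|\cdot|^2]\Big)^\star+\big(\rho\circ g+\iota_{L^2(\mathcal G)}\big)^\star,\qquad \alpha=\big(\mathbb E[|\cdot|^2]\big)^\star+\sigma_{L^2(\mathcal G)\cap\Phi}.$$ Let $(X_t)_{t\ge0}$ be an adapted, a.s. positive process with $X_t\in L^2(\mathcal F_t)$ for all $t$. Then: 1. For every $X\in L^2(\mathcal F)$ and every multiplier $\kappa$ at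 $X$, with $\eta=\kappa/2>0$, $\mathcal R^0(X)$ is a single point and $$\mathcal R^0(X)=\operatorname*{argmin}_{Z\in L^2(\mathcal G)}\tfrac12\mathbb E[|X-Z|^2]+\eta\,\rho(g(Z))=\operatorname{Prox}_{\eta\,\rho\circ g+\iota_{L^2(\mathcal G)}}(X),$$ where $\operatorname{Prox}_F(X)=\operatorname{argmin}_{Z\in L^2(\mathcal F)}\tfrac12\mathbb E[|X-Z|^2]+F(Z)$. 2. For every $t$ with $\mathcal G\subseteq\mathcal F_t$ and every multiplier $\kappa$ at $X_t$, with $\eta=\kappa/2>0$, $\mathcal V_{\alpha_\eta}$ is Gâteaux differentiable at $X_t$ in $L^2(\mathcal F)$ and $$\mathcal R^0(X_t)=X_t-\eta\,\nabla\Big(\sup_{\tilde X_t\in\mathcal M^t_{alt}(X_t)}\mathbb E[\tilde X_t]-\alpha_\eta\big(\tilde X_t/X_t\big)\Big).$$ 3. For every $t$ with $\mathcal G\subseteq\mathcal F_t$, $\mathcal V_{\alpha}$ is Gâteaux differentiable at $X_t$ in $L^2(\mathcal F)$ and $$\mathcal R^0(X_t)=X_t-\tfrac12\,\nabla\Big(\sup_{\tilde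 X_t\in\mathcal M^t_{alt}(X_t)}\mathbb E[\tilde X_t]-\alpha\big(\tilde X_t/X_t\big)\Big).$$ In this sense $\mathcal R^0(X_t)$ is a robust analogue of a sensitivity-neutral portfolio. -/

import Mathlib

open MeasureTheory Set Filter Topology
open scoped NNReal ENNReal

noncomputable section

namespace RobustNeutral

/-! Throughout, `Lp ℝ 2 μ` is the Hilbert space `L²(ℱ)` of square-integrable random variables, so that
`‖X - Z‖ ^ 2` is `E[|X - Z|²]` and `inner ℝ Z Y` is `E[Z Y]`. -/

/-- The closed subspace `L²(m)` of `L²(ℱ)`, for a sub-σ-algebra `m` of `ℱ`. -/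
abbrev subL2 {Ω : Type*} (m : MeasurableSpace Ω) {mΩ : MeasurableSpace Ω} (μ : Measure Ω) :
    Submodule ℝ (Lp ℝ 2 μ) :=
  lpMeas ℝ ℝ m 2 μ

section Convex

variable {E : Type*}

/-- The set of minimizers of an extended-real function `F` over the set `S`. -/
def arginf (S : Set E) (F : E → EReal) : Set E :=
  {Z | Z ∈ S ∧ ∀ W ∈ S, F Z ≤ F W}

/-- The convex-analytic indicator function of a set: `0` on the set and `∞` outside of it. -/
def indicatorFn (S : Set E) (Z : E) : EReal :=
  open Classical in if Z ∈ S then 0 else ⊤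

/-- Convexity of an extended-real valued function. -/
def IsConvexFn [AddCommGroup E] [Module ℝ E] (F : E → EReal) : Prop :=
  ∀ X Y : E, ∀ a : ℝ, 0 ≤ a → a ≤ 1 →
    F (a • X + (1 - a) • Y) ≤ (a : EReal) * F X + ((1 - a : ℝ) : EReal) * F Y

/-- Properness: the value `-∞` is never attained, and some value is finite. -/
def IsProperFn (F : E → EReal) : Prop :=
  (∀ X, F X ≠ ⊥) ∧ ∃ X, F X ≠ ⊤

variable [NormedAddCommGroup E] [InnerProductSpace ℝ E]

/-- The Fenchel–Moreau conjugate `F⋆(Z) = sup_Y (⟨Z, Y⟩ - F(Y))`. -/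
def conjugate (F : E → EReal) (Z : E) : EReal :=
  ⨆ Y : E, ((inner ℝ Z Y : ℝ) : EReal) - F Y

/-- The support function `σ_C(Z) = sup_{Y ∈ C} ⟨Z, Y⟩`. -/
def supportFn (C : Set E) (Z : E) : EReal :=
  ⨆ Y ∈ C, ((inner ℝ Z Y : ℝ) : EReal)

/-- The proximal map `Prox_F(X)`, as the set of minimizers of `½‖X - Z‖² + F(Z)`. -/
def prox (F : E → EReal) (X : E) : Set E :=
  arginf Set.univ fun Z => ((1 / 2 * ‖X - Z‖ ^ 2 : ℝ) : EReal) + F Z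

/-- `D` is the Gâteaux derivative (gradient) at `X` of the extended-real function `F`, which is
finite at `X` and, along every ray issued from `X`, near `X`. -/
def HasGateauxGradient (F : E → EReal) (X D : E) : Prop :=
  (F X ≠ ⊤ ∧ F X ≠ ⊥) ∧
  ∀ H : E,
    (∀ᶠ ε : ℝ in 𝓝[>] 0, F (X + ε • H) ≠ ⊤ ∧ F (X + ε • H) ≠ ⊥) ∧
    Tendsto (fun ε : ℝ => ((F (X + ε • H)).toReal - (F X).toReal) / ε) (𝓝[>] 0)
      (𝓝 (inner ℝ H D))

end Convex

section Risk

variable {Ω : Type*} {mΩ : MeasurableSpace Ω} {μ : Measure Ω}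

/-- A proper convex risk-measure on `L²` with values in `(-∞, ∞]`: decreasing, cash-invariant,
convex, and finite somewhere. -/
structure IsConvexRiskMeasure [IsProbabilityMeasure μ] (ρ : Lp ℝ 2 μ → EReal) : Prop where
  proper : IsProperFn ρ
  antitone : ∀ X Y : Lp ℝ 2 μ, X ≤ Y → ρ Y ≤ ρ X
  cash : ∀ (X : Lp ℝ 2 μ) (k : ℝ), ρ (X + Lp.const 2 μ k) = ρ X - (k : EReal)
  convex : IsConvexFn ρ

/-- The acceptance set of `ρ`. -/
def acceptanceSet (ρ : Lp ℝ 2 μ → EReal) : Set (Lp ℝ 2 μ) :=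
  {Z | ρ Z ≤ 0}

/-- A risk-perspective `(𝒢, ρ, U, Φ, M)`. -/
structure RiskPerspective (μ : Measure Ω) [IsProbabilityMeasure μ] where
  /-- the sub-σ-algebra -/
  𝒢 : MeasurableSpace Ω
  le : 𝒢 ≤ mΩ
  /-- the risk-measure -/
  ρ : Lp ℝ 2 μ → EReal
  risk : IsConvexRiskMeasure ρ
  accept_nonempty : (acceptanceSet ρ).Nonempty
  accept_closed : IsClosed (acceptanceSet ρ)
  /-- the compatible utility operator -/
  U : Lp ℝ 2 μ → subL2 𝒢 μ
  util_proper : IsProperFn fun Z => ρ (U Z)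
  util_convex : IsConvexFn fun Z => ρ (U Z)
  util_lsc : LowerSemicontinuous fun Z => ρ (U Z)
  util_bdd : ⊥ < ⨅ Z : subL2 𝒢 μ, ρ (U Z)
  /-- the feature set -/
  Φ : Set (Lp ℝ 2 μ)
  feat_nonempty : Φ.Nonempty
  feat_convex : Convex ℝ Φ
  feat_closed : IsClosed Φ
  feat_compat : ((subL2 𝒢 μ : Set (Lp ℝ 2 μ)) ∩ Φ ∩ acceptanceSet ρ ∩
    {Z | ρ (U Z) < ⊤}).Nonempty
  /-- the risk-aversion level -/
  M : EReal
  M_pos : 0 < M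

/-- The composition `R ∘ g` on `L²`, with value `∞` where `g(Z)` is not square-integrable. -/
def aggRisk (R : Lp ℝ 2 μ → EReal) (g : ℝ → ℝ) (Z : Lp ℝ 2 μ) : EReal :=
  open Classical in if h : MemLp (fun ω => g (Z ω)) 2 μ then R h.toLp else ⊤

/-- The shifted aggregated acceptance set `{Z ∈ L² : R(g(Z)) ≤ m}`. -/
def aggAcceptanceSet (R : Lp ℝ 2 μ → EReal) (g : ℝ → ℝ) (m : ℝ) : Set (Lp ℝ 2 μ) :=
  {Z | aggRisk R g Z ≤ (m : EReal)}

namespace RiskPerspective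

variable [IsProbabilityMeasure μ] (P : RiskPerspective μ)

/-- The space `L²(𝒢)`. -/
def L2G : Set (Lp ℝ 2 μ) := (subL2 P.𝒢 μ : Set (Lp ℝ 2 μ))

/-- `(1 - l) E[|Y|²] + l ρ(U(Y))`. -/
def loss (l : ℝ) (Y : Lp ℝ 2 μ) : EReal :=
  (((1 - l) * ‖Y‖ ^ 2 : ℝ) : EReal) + (l : EReal) * P.ρ (P.U Y)

/-- The conditioning operator `ℛ^l` of the risk-perspective, as the set of minimizers over
`L²(𝒢) ∩ Φ` of `(1 - l) E[|X - Z|²] + l ρ(U(X - Z))`. -/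
def conditioning (l : ℝ) (X : Lp ℝ 2 μ) : Set (Lp ℝ 2 μ) :=
  arginf (P.L2G ∩ P.Φ) fun Z => P.loss l (X - Z)

/-- `κ > 0` is a Lagrange multiplier at `X` for the constraint `ρ(g(Z)) ≤ m`. -/
def IsMultiplier (g : ℝ → ℝ) (m l : ℝ) (X : Lp ℝ 2 μ) (κ : ℝ) : Prop :=
  0 < κ ∧
  arginf (P.L2G ∩ aggAcceptanceSet P.ρ g m) (fun Z => P.loss l (X - Z)) =
    arginf P.L2G
      (fun Z => P.loss l (X - Z) + (κ : EReal) * (aggRisk P.ρ g Z - (m : EReal))) ∧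
  arginf P.L2G
      (fun Z => P.loss l (X - Z) + (κ : EReal) * (aggRisk P.ρ g Z - (m : EReal))) =
    arginf P.L2G (fun Z => P.loss l (X - Z) + (κ : EReal) * aggRisk P.ρ g Z)

/-- The penalty of the robust representation of the optimal value of the constrained problem:
`(loss)⋆ + σ_{L²(𝒢) ∩ Φ}`. -/
def penalty (l : ℝ) (Z : Lp ℝ 2 μ) : EReal :=
  conjugate (P.loss l) Z + supportFn (P.L2G ∩ P.Φ) Z

/-- The penalty of the robust representation of the optimal value of the Lagrangian problem
`inf_{Z ∈ L²(𝒢)} (1/(2η)) E[|X - Z|²] + ρ(g(Z))`: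
`((1/(2η)) E[|·|²])⋆ + (ρ ∘ g + ι_{L²(𝒢)})⋆`. -/
def lagrangePenalty (g : ℝ → ℝ) (η : ℝ) (Z : Lp ℝ 2 μ) : EReal :=
  conjugate (fun Y : Lp ℝ 2 μ => ((1 / (2 * η) * ‖Y‖ ^ 2 : ℝ) : EReal)) Z +
    conjugate (fun Y => aggRisk P.ρ g Y + indicatorFn P.L2G Y) Z

end RiskPerspective

/-- The alternative models of `X`: the (integrable) products `Y X` with a density `Y ∈ L²(m)`. -/
def altModels (m : MeasurableSpace Ω) (X : Lp ℝ 2 μ) : Set (Lp ℝ 1 μ) :=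
  {X' | ∃ Y ∈ subL2 m μ, X' =ᵐ[μ] fun ω => Y ω * X ω}

/-- `sup E[X'] - α(X' / X)` over the alternative models `X'` of `X`. The quotient `X' / X` is taken
as any `Z ∈ L²(m)` with `X' = Z X` a.s.; it is unique if `X ≠ 0` a.s. (see
`robustValue_eq_quotient`), and this makes sense at every point `X` of `L²`, as is needed to
differentiate. -/
def robustValue (m : MeasurableSpace Ω) (α : Lp ℝ 2 μ → EReal) (X : Lp ℝ 2 μ) : EReal :=
  ⨆ X' ∈ altModels m X, ⨆ Z ∈ subL2 m μ, ⨆ _ : X' =ᵐ[μ] fun ω => Z ω * X ω,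
    ((∫ ω, X' ω ∂μ : ℝ) : EReal) - α Z

/-- The pointwise quotient `X' / X`, as an element of `L²` (when it is square-integrable). -/
def quotientL2 (X' : Lp ℝ 1 μ) (X : Lp ℝ 2 μ) : Lp ℝ 2 μ :=
  open Classical in if h : MemLp (fun ω => X' ω / X ω) 2 μ then h.toLp else 0

theorem quotientL2_eq {X' : Lp ℝ 1 μ} {X Z : Lp ℝ 2 μ} (hX : ∀ᵐ ω ∂μ, X ω ≠ 0)
    (h : X' =ᵐ[μ] fun ω => Z ω * X ω) : quotientL2 X' X = Z := by
  have hZ : (fun ω => X' ω / X ω) =ᵐ[μ] Z := by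
    filter_upwards [hX, h] with ω h1 h2
    rw [h2, mul_div_assoc, div_self h1, mul_one]
  have hm : MemLp (fun ω => X' ω / X ω) 2 μ := (memLp_congr_ae hZ).2 (Lp.memLp Z)
  rw [quotientL2, dif_pos hm]
  exact Lp.ext ((MemLp.coeFn_toLp hm).trans hZ)

theorem robustValue_eq_quotient (m : MeasurableSpace Ω) (α : Lp ℝ 2 μ → EReal) (X : Lp ℝ 2 μ)
    (hX : ∀ᵐ ω ∂μ, X ω ≠ 0) :
    robustValue m α X =
      ⨆ X' ∈ altModels m X, ((∫ ω, X' ω ∂μ : ℝ) : EReal) - α (quotientL2 X' X) := by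
  refine iSup_congr fun X' => iSup_congr fun hX' => le_antisymm ?_ ?_
  · refine iSup_le fun Z => iSup_le fun _ => iSup_le fun h => ?_
    rw [quotientL2_eq hX h]
  · obtain ⟨Z, hZ, h⟩ := hX'
    rw [quotientL2_eq hX h]
    exact le_iSup_of_le Z (le_iSup_of_le hZ (le_iSup_of_le h le_rfl))

end Risk

end RobustNeutral

end

open MeasureTheory Set Filter Topology

namespace RobustNeutral

/-! ### Convex analysis in a Hilbert space: gradients, conjugates, optimality, projection. -/

section Convex

variable {E : Type*} [NormedAddCommGroup E] [InnerProductSpace ℝ E]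

/-! Both penalties have the form `q⋆ + f⋆` with `q = ‖·‖²/(2η)`: in the Lagrangian case `f = ρ ∘ g +
ι_{L²(𝒢)}`, in the constrained case `f = ι_{L²(𝒢) ∩ Φ}` and `η = 1/2`. The robust value is the
conjugate of the penalty with the supremum restricted to `L²(ℱ_t)` (`robustValue_eq_iSup`), formally
the Moreau envelope of `f`, whose gradient at `X` is `(X - Prox X)/η`.

No duality theorem is needed. Let `Z₀` be the minimizer and `D = (X - Z₀)/η`, a subgradient of `f`
at `Z₀`. Testing the supremum at `D` bounds the value at `X + Y` below by an affine function of `Y`;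
the Fenchel inequality for `f⋆` at `Z₀` bounds it above by the same function plus `‖Y‖²/(2η)`. This
squeeze (`HasGateauxGradient.of_le_quadratic`) yields the gradient `D`. The lower bound needs `D ∈
L²(ℱ_t)`, which follows from adaptedness and `𝒢 ⊆ ℱ_t`.

That `D` is a subgradient comes from `subgradient_of_isMin` in the Lagrangian case and from the
obtuse-angle property of the projection in the constrained case. The prox identity follows from the
multiplier property by halving the objective and absorbing the constraint into an indicator. -/

/-- A function squeezed between an affine function and the same function plus a multiple of the
squared distance to `X` has the slope of the affine function as Gâteaux gradient at `X`. -/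
theorem HasGateauxGradient.of_le_quadratic {F : E → EReal} {X D : E} {v c : ℝ}
    (hl : ∀ Y, ((v + inner ℝ Y D : ℝ) : EReal) ≤ F (X + Y))
    (hu : ∀ Y, F (X + Y) ≤ ((v + inner ℝ Y D + c * ‖Y‖ ^ 2 : ℝ) : EReal)) :
    HasGateauxGradient F X D := by
  have hfin : ∀ Y, F (X + Y) ≠ ⊤ ∧ F (X + Y) ≠ ⊥ := fun Y =>
    ⟨ne_top_of_le_ne_top (EReal.coe_ne_top _) (hu Y),
      ne_bot_of_le_ne_bot (EReal.coe_ne_bot _) (hl Y)⟩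
  have hl' : ∀ Y, v + inner ℝ Y D ≤ (F (X + Y)).toReal := fun Y => by
    have h := hl Y
    rw [← EReal.coe_toReal (hfin Y).1 (hfin Y).2] at h
    exact_mod_cast h
  have hu' : ∀ Y, (F (X + Y)).toReal ≤ v + inner ℝ Y D + c * ‖Y‖ ^ 2 := fun Y => by
    have h := hu Y
    rw [← EReal.coe_toReal (hfin Y).1 (hfin Y).2] at h
    exact_mod_cast h
  have h0 : (F X).toReal = v := by
    have h1 := hl' 0
    have h2 := hu' 0
    simp only [inner_zero_left, norm_zero, add_zero] at h1 h2
    linarith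
  refine ⟨by simpa using hfin 0, fun H => ⟨Eventually.of_forall fun ε => hfin _, ?_⟩⟩
  have hlim : Tendsto (fun ε : ℝ => inner ℝ H D + ε * (c * ‖H‖ ^ 2)) (𝓝[>] 0)
      (𝓝 (inner ℝ H D)) := by
    have : Continuous fun ε : ℝ => inner ℝ H D + ε * (c * ‖H‖ ^ 2) := by fun_prop
    simpa using (this.tendsto 0).mono_left nhdsWithin_le_nhds
  refine tendsto_of_tendsto_of_tendsto_of_le_of_le' tendsto_const_nhds hlim ?_ ?_
  · filter_upwards [self_mem_nhdsWithin] with ε hε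
    have hε : 0 < ε := hε
    have h := hl' (ε • H)
    rw [inner_smul_left] at h
    simp only [conj_trivial] at h
    rw [le_div_iff₀ hε, h0]
    linarith
  · filter_upwards [self_mem_nhdsWithin] with ε hε
    have hε : 0 < ε := hε
    have h := hu' (ε • H)
    rw [inner_smul_left, norm_smul, mul_pow, Real.norm_eq_abs, sq_abs] at h
    simp only [conj_trivial] at h
    rw [div_le_iff₀ hε, h0]
    linarith

/-- The supremum is attained at `Y = η Z`; the gap at any other `Y` is `‖η Z - Y‖²/(2η)`. -/
theorem conjugate_sq_norm {η : ℝ} (hη : 0 < η) (Z : E) :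
    conjugate (fun Y : E => ((1 / (2 * η) * ‖Y‖ ^ 2 : ℝ) : EReal)) Z =
      ((η / 2 * ‖Z‖ ^ 2 : ℝ) : EReal) := by
  refine le_antisymm (iSup_le fun Y => ?_) (le_iSup_of_le (η • Z) ?_)
  · have h : 0 ≤ ‖η • Z - Y‖ ^ 2 := sq_nonneg _
    rw [norm_sub_sq_real, inner_smul_left, norm_smul, mul_pow, Real.norm_eq_abs, sq_abs] at h
    simp only [conj_trivial] at h
    rw [← EReal.coe_sub, EReal.coe_le_coe_iff, ← sub_nonneg]
    have : η / 2 * ‖Z‖ ^ 2 - (inner ℝ Z Y - 1 / (2 * η) * ‖Y‖ ^ 2) =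
        1 / (2 * η) * (η ^ 2 * ‖Z‖ ^ 2 - 2 * (η * inner ℝ Z Y) + ‖Y‖ ^ 2) := by
      field_simp
      ring
    rw [this]
    positivity
  · rw [← EReal.coe_sub, EReal.coe_le_coe_iff, inner_smul_right, real_inner_self_eq_norm_sq,
      norm_smul, mul_pow, Real.norm_eq_abs, sq_abs]
    apply le_of_eq
    field_simp
    ring

theorem conjugate_indicatorFn (C : Set E) (Z : E) :
    conjugate (indicatorFn C) Z = supportFn C Z := by
  refine iSup_congr fun Y => ?_
  by_cases h : Y ∈ C <;> simp [indicatorFn, h]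

/-- The Fenchel inequality at a point where the function is finite. -/
theorem le_conjugate_of_eq {f : E → EReal} {Z₀ : E} {r : ℝ} (h : f Z₀ = r) (Z : E) :
    ((inner ℝ Z Z₀ - r : ℝ) : EReal) ≤ conjugate f Z := by
  refine le_iSup_of_le Z₀ ?_
  rw [h, EReal.coe_sub]

/-- The Fenchel equality, as an inequality, at a subgradient. -/
theorem conjugate_le_of_subgradient {f : E → EReal} {Z₀ D : E} {r : ℝ}
    (h : ∀ Y, ((r + inner ℝ D (Y - Z₀) : ℝ) : EReal) ≤ f Y) :
    conjugate f D ≤ ((inner ℝ D Z₀ - r : ℝ) : EReal) := by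
  refine iSup_le fun Y => ?_
  refine (EReal.sub_le_sub le_rfl (h Y)).trans ?_
  rw [← EReal.coe_sub, EReal.coe_le_coe_iff, inner_sub_right]
  linarith

/-- First-order optimality condition for `½‖X - Z‖² + η f(Z)` with a convex function `f`. -/
theorem subgradient_of_isMin {f : E → EReal} (hf : IsConvexFn f) (hbot : ∀ Z, f Z ≠ ⊥)
    {S : Set E} (hS : Convex ℝ S) {η : ℝ} (hη : 0 < η) {X D Z₀ : E} (hZ₀ : Z₀ ∈ S)
    (hX : X = Z₀ + η • D) {r : ℝ} (hr : f Z₀ = r)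
    (hmin : ∀ Z ∈ S, ((‖X - Z₀‖ ^ 2 : ℝ) : EReal) + ((2 * η : ℝ) : EReal) * f Z₀ ≤
      ((‖X - Z‖ ^ 2 : ℝ) : EReal) + ((2 * η : ℝ) : EReal) * f Z) :
    ∀ Y ∈ S, ((r + inner ℝ D (Y - Z₀) : ℝ) : EReal) ≤ f Y := by
  intro Y hY
  rcases eq_or_ne (f Y) ⊤ with htop | htop
  · rw [htop]
    exact le_top
  lift f Y to ℝ using ⟨htop, hbot Y⟩ with y hy
  rw [EReal.coe_le_coe_iff]
  set d := Y - Z₀ with hd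
  -- Compare `Z₀` with the point `W` a fraction `a` of the way to `Y`: the first-order terms are
  -- linear in `a`, the remainder is `a² ‖d‖²`, so dividing by `a` leaves an error that vanishes as
  -- `a → 0`.
  have key : ∀ a : ℝ, 0 < a → a ≤ 1 → 2 * η * (r + inner ℝ D d - y) ≤ a * ‖d‖ ^ 2 := by
    intro a ha ha1
    have hc := hf Y Z₀ a ha.le ha1
    have hm := hmin _ (hS hY hZ₀ ha.le (sub_nonneg.2 ha1) (by ring))
    set W := a • Y + (1 - a) • Z₀ with hW
    have hXW : X - W = η • D - a • d := by
      rw [hW, hX, hd]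
      module
    have hX0 : X - Z₀ = η • D := by rw [hX, add_sub_cancel_left]
    rw [← hy, hr] at hc
    have hc' : f W ≤ ((a * y + (1 - a) * r : ℝ) : EReal) := by exact_mod_cast hc
    have hm' := hm.trans (add_le_add_right (mul_le_mul_of_nonneg_left hc'
      (EReal.coe_nonneg.2 (by positivity : 0 ≤ 2 * η))) _)
    rw [hr] at hm'
    have h : ‖X - Z₀‖ ^ 2 + 2 * η * r ≤ ‖X - W‖ ^ 2 + 2 * η * (a * y + (1 - a) * r) := by
      exact_mod_cast hm'
    rw [hX0, hXW, norm_sub_sq_real (η • D), inner_smul_left, inner_smul_right,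
      norm_smul a, mul_pow, Real.norm_eq_abs, sq_abs] at h
    simp only [conj_trivial] at h
    refine le_of_mul_le_mul_left ?_ ha
    linarith
  have hlim : Tendsto (fun a : ℝ => a * ‖d‖ ^ 2) (𝓝[>] 0) (𝓝 0) := by
    have : Continuous fun a : ℝ => a * ‖d‖ ^ 2 := by fun_prop
    simpa using (this.tendsto 0).mono_left nhdsWithin_le_nhds
  have h0 : 2 * η * (r + inner ℝ D d - y) ≤ 0 := by
    refine ge_of_tendsto hlim ?_
    filter_upwards [Ioc_mem_nhdsGT (zero_lt_one' ℝ)] with a ha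
    exact key a ha.1 ha.2
  have := nonpos_of_mul_nonpos_right h0 (by positivity : 0 < 2 * η)
  linarith

/-- The metric projection onto a nonempty closed convex set. -/
theorem exists_projection [CompleteSpace E] {C : Set E} (hne : C.Nonempty) (hcl : IsClosed C)
    (hconv : Convex ℝ C) (X : E) :
    ∃ Z₀ ∈ C, (∀ Y ∈ C, inner ℝ (X - Z₀) (Y - Z₀) ≤ 0) ∧
      arginf C (fun Z => ((‖X - Z‖ ^ 2 : ℝ) : EReal)) = {Z₀} := by
  obtain ⟨Z₀, hZ₀, h⟩ := exists_norm_eq_iInf_of_complete_convex hne hcl.isComplete hconv X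
  have hin := (norm_eq_iInf_iff_real_inner_le_zero hconv hZ₀).1 h
  have hexp : ∀ Y ∈ C, ‖X - Z₀‖ ^ 2 + ‖Y - Z₀‖ ^ 2 ≤ ‖X - Y‖ ^ 2 := fun Y hY => by
    have h1 := norm_sub_sq_real (X - Z₀) (Y - Z₀)
    rw [sub_sub_sub_cancel_right] at h1
    linarith [hin Y hY]
  refine ⟨Z₀, hZ₀, hin, Set.eq_singleton_iff_unique_mem.2 ⟨⟨hZ₀, fun Y hY => ?_⟩, ?_⟩⟩
  · rw [EReal.coe_le_coe_iff]
    linarith [hexp Y hY, sq_nonneg ‖Y - Z₀‖]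
  · rintro Y ⟨hY, hYmin⟩
    have h1 := EReal.coe_le_coe_iff.1 (hYmin Z₀ hZ₀)
    have h2 : ‖Y - Z₀‖ ^ 2 ≤ 0 := by linarith [hexp Y hY]
    have h3 : ‖Y - Z₀‖ = 0 := by nlinarith [norm_nonneg (Y - Z₀)]
    exact sub_eq_zero.1 (norm_eq_zero.1 h3)

end Convex

/-! ### Rescaling objectives and absorbing constraints into indicators. -/

section Arginf

variable {E : Type*}

theorem arginf_congr_of_le_iff {S : Set E} {F G : E → EReal}
    (h : ∀ Z W, F Z ≤ F W ↔ G Z ≤ G W) : arginf S F = arginf S G := by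
  ext Z
  simp only [arginf, h]

theorem arginf_half {S : Set E} (q : E → ℝ) (f : E → EReal) {κ : ℝ} (hκ : 0 < κ)
    (hbot : ∀ Z, f Z ≠ ⊥) :
    arginf S (fun Z => ((1 / 2 * q Z : ℝ) : EReal) + ((κ / 2 : ℝ) : EReal) * f Z) =
      arginf S (fun Z => (q Z : EReal) + (κ : EReal) * f Z) := by
  refine arginf_congr_of_le_iff fun Z W => ?_
  have hκ2 : 0 < κ / 2 := half_pos hκ
  rcases eq_or_ne (f W) ⊤ with hW | hW
  · rw [hW, EReal.coe_mul_top_of_pos hκ, EReal.coe_mul_top_of_pos hκ2, EReal.coe_add_top,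
      EReal.coe_add_top]
    simp only [le_top]
  lift f W to ℝ using ⟨hW, hbot W⟩ with w
  rcases eq_or_ne (f Z) ⊤ with hZ | hZ
  · rw [hZ, EReal.coe_mul_top_of_pos hκ, EReal.coe_mul_top_of_pos hκ2, EReal.coe_add_top,
      EReal.coe_add_top, top_le_iff, top_le_iff]
    simp only [← EReal.coe_mul, ← EReal.coe_add, EReal.coe_ne_top]
  lift f Z to ℝ using ⟨hZ, hbot Z⟩ with z
  simp only [← EReal.coe_mul, ← EReal.coe_add, EReal.coe_le_coe_iff]
  constructor <;> intro h <;> linarith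

/-- Minimizing over `S` is the same as minimizing after adding the indicator function of `S`. -/
theorem arginf_univ_add_indicatorFn {S : Set E} {F : E → EReal} (hbot : ∀ Z, F Z ≠ ⊥)
    (hfin : ∃ Z ∈ S, F Z ≠ ⊤) :
    arginf Set.univ (fun Z => F Z + indicatorFn S Z) = arginf S F := by
  have hin : ∀ Z ∈ S, F Z + indicatorFn S Z = F Z := fun Z hZ => by simp [indicatorFn, hZ]
  -- The bound `F Z ≠ ⊥` matters because `⊥ + ⊤ = ⊥` in `EReal`.
  have hout : ∀ Z ∉ S, F Z + indicatorFn S Z = ⊤ := fun Z hZ => by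
    simp only [indicatorFn, hZ, if_false]
    exact EReal.add_top_of_ne_bot (hbot Z)
  obtain ⟨V, hV, hVtop⟩ := hfin
  ext Z
  constructor
  · rintro ⟨-, h⟩
    have hZ : Z ∈ S := by
      by_contra hZ
      have h1 := h V trivial
      simp only [hout Z hZ, hin V hV] at h1
      exact hVtop (top_le_iff.1 h1)
    refine ⟨hZ, fun W hW => ?_⟩
    have h1 := h W trivial
    simpa only [hin Z hZ, hin W hW] using h1
  · rintro ⟨hZ, h⟩
    refine ⟨trivial, fun W _ => ?_⟩
    by_cases hW : W ∈ S
    · simpa only [hin Z hZ, hin W hW] using h W hW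
    · simp only [hout W hW, le_top]

end Arginf

/-! ### Robust values as conjugates, and conditioning as projection. -/

section Risk

variable {Ω : Type*} {mΩ : MeasurableSpace Ω} {μ : Measure Ω}

/-- The robust value is a partial conjugate of the penalty. -/
theorem robustValue_eq_iSup (m : MeasurableSpace Ω) (α : Lp ℝ 2 μ → EReal) (X : Lp ℝ 2 μ) :
    robustValue m α X = ⨆ Z ∈ subL2 m μ, ((inner ℝ Z X : ℝ) : EReal) - α Z := by
  have hint : ∀ Z : Lp ℝ 2 μ, inner ℝ Z X = ∫ ω, Z ω * X ω ∂μ := fun Z => by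
    rw [L2.inner_def]
    exact integral_congr_ae (Eventually.of_forall fun ω => by simp [mul_comm])
  refine le_antisymm ?_ ?_
  · refine iSup_le fun X' => iSup_le fun _ => iSup_le fun Z => iSup_le fun hZ => iSup_le fun h => ?_
    refine le_iSup_of_le Z (le_iSup_of_le hZ ?_)
    rw [hint, integral_congr_ae h]
  · refine iSup_le fun Z => iSup_le fun hZ => ?_
    -- A product of two `L²` functions is integrable, so every density `Z` is realized by an
    -- alternative model.
    have hi : Integrable (fun ω => Z ω * X ω) μ := by
      refine (L2.integrable_inner (𝕜 := ℝ) Z X).congr (Eventually.of_forall fun ω => ?_)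
      simp [mul_comm]
    have h : (hi.toL1 _ : Ω → ℝ) =ᵐ[μ] fun ω => Z ω * X ω := hi.coeFn_toL1
    refine le_iSup_of_le (hi.toL1 _) (le_iSup_of_le ⟨Z, hZ, h⟩ (le_iSup_of_le Z
      (le_iSup_of_le hZ (le_iSup_of_le h ?_))))
    rw [hint, integral_congr_ae h]

/-- The robust value with penalty `((1/(2η))‖·‖²)⋆ + f⋆` is differentiable at `Z₀ + η D` for every
subgradient `D` of `f` at `Z₀` that is measurable for the given σ-algebra, with gradient `D`. -/
theorem hasGateauxGradient_robustValue {m : MeasurableSpace Ω} {f : Lp ℝ 2 μ → EReal} {η : ℝ}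
    (hη : 0 < η) {X Z₀ D : Lp ℝ 2 μ} {r : ℝ} (hX : X = Z₀ + η • D) (hD : D ∈ subL2 m μ)
    (hr : f Z₀ = r) (hsub : ∀ Y, ((r + inner ℝ D (Y - Z₀) : ℝ) : EReal) ≤ f Y) :
    HasGateauxGradient (robustValue m fun Z =>
      conjugate (fun Y : Lp ℝ 2 μ => ((1 / (2 * η) * ‖Y‖ ^ 2 : ℝ) : EReal)) Z + conjugate f Z)
      X D := by
  -- `v` is `‖X - Z₀‖²/(2η) + f Z₀`, since `X - Z₀ = η D`.
  refine .of_le_quadratic (v := η / 2 * ‖D‖ ^ 2 + r) (c := 1 / (2 * η)) (fun Y => ?_) fun Y => ?_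
  · rw [robustValue_eq_iSup]
    refine le_iSup_of_le D (le_iSup_of_le hD ?_)
    rw [conjugate_sq_norm hη]
    refine le_trans ?_ (EReal.sub_le_sub le_rfl
      (add_le_add_right (conjugate_le_of_subgradient hsub) _))
    rw [← EReal.coe_add, ← EReal.coe_sub, EReal.coe_le_coe_iff, hX, inner_add_right,
      inner_add_right, inner_smul_right, real_inner_self_eq_norm_sq, real_inner_comm]
    linarith
  · rw [robustValue_eq_iSup]
    refine iSup_le fun Z => iSup_le fun _ => ?_
    rw [conjugate_sq_norm hη]
    refine (EReal.sub_le_sub le_rfl (add_le_add_right (le_conjugate_of_eq hr Z) _)).trans ?_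
    rw [← EReal.coe_add, ← EReal.coe_sub, EReal.coe_le_coe_iff, hX, inner_add_right,
      inner_add_right, inner_smul_right, ← sub_nonneg]
    -- This square is exactly the gap between the two sides, obtained by maximizing the concave
    -- quadratic in `Z`.
    have h : 0 ≤ 1 / (2 * η) * ‖η • (Z - D) - Y‖ ^ 2 := by positivity
    rw [norm_sub_sq_real, inner_smul_left, norm_smul, mul_pow, Real.norm_eq_abs, sq_abs,
      norm_sub_sq_real, inner_sub_left, real_inner_comm Y D] at h
    simp only [conj_trivial] at h
    refine h.trans_eq ?_
    field_simp
    ring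

theorem aggRisk_ne_bot {R : Lp ℝ 2 μ → EReal} (hR : ∀ Z, R Z ≠ ⊥) (g : ℝ → ℝ) (Z : Lp ℝ 2 μ) :
    aggRisk R g Z ≠ ⊥ := by
  unfold aggRisk
  split_ifs
  · exact hR _
  · exact top_ne_bot

theorem subL2_mono {m₁ m₂ : MeasurableSpace Ω} (h : m₁ ≤ m₂) :
    subL2 m₁ μ ≤ subL2 m₂ μ := fun Z hZ => by
  rw [mem_lpMeas_iff_aestronglyMeasurable] at hZ ⊢
  exact hZ.mono h

namespace RiskPerspective

variable [IsProbabilityMeasure μ] (P : RiskPerspective μ)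

theorem loss_zero (Y : Lp ℝ 2 μ) : P.loss 0 Y = ((‖Y‖ ^ 2 : ℝ) : EReal) := by
  simp [loss]

/-- At risk-aversion zero the conditioning operator is the projection onto `L²(𝒢) ∩ Φ`. -/
theorem exists_conditioning_zero_eq (X : Lp ℝ 2 μ) :
    ∃ Z₀ ∈ P.L2G ∩ P.Φ, (∀ Y ∈ P.L2G ∩ P.Φ, inner ℝ (X - Z₀) (Y - Z₀) ≤ 0) ∧
      P.conditioning 0 X = {Z₀} := by
  have hcl : IsClosed P.L2G := isClosed_aestronglyMeasurable P.le
  have hne : (P.L2G ∩ P.Φ).Nonempty := by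
    obtain ⟨Z, hZ⟩ := P.feat_compat
    exact ⟨Z, hZ.1.1⟩
  obtain ⟨Z₀, h1, h2, h3⟩ := exists_projection hne (hcl.inter P.feat_closed)
    ((subL2 P.𝒢 μ).convex.inter P.feat_convex) X
  refine ⟨Z₀, h1, h2, ?_⟩
  rw [← h3]
  simp only [conditioning, loss_zero]

variable {P} {g : ℝ → ℝ} {m : ℝ}

/-- With a multiplier, the conditioning operator minimizes the Lagrangian. -/
theorem IsMultiplier.conditioning_eq {X : Lp ℝ 2 μ} {κ : ℝ} (h : P.IsMultiplier g m 0 X κ)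
    (hΦ : P.Φ = aggAcceptanceSet P.ρ g m) :
    P.conditioning 0 X = arginf P.L2G
      (fun Z => ((‖X - Z‖ ^ 2 : ℝ) : EReal) + (κ : EReal) * aggRisk P.ρ g Z) := by
  have h1 := h.2.1.trans h.2.2
  rw [← hΦ] at h1
  rw [conditioning, h1]
  simp only [loss_zero]

end RiskPerspective

end Risk

end RobustNeutral

/-! ### The three claims: proximal form, Lagrangian gradient, constrained gradient. -/

theorem mainTheorem10 {Ω : Type*} {mΩ : MeasurableSpace Ω} (μ : Measure Ω)
    [IsProbabilityMeasure μ]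
    (P : RobustNeutral.RiskPerspective μ)
    (hlsc : LowerSemicontinuous P.ρ)
    (g : ℝ → ℝ) (hg : Continuous g)
    (hconv : RobustNeutral.IsConvexFn (RobustNeutral.aggRisk P.ρ g))
    (m : ℝ) (hm : 0 ≤ m)
    (hΦ : P.Φ = RobustNeutral.aggAcceptanceSet P.ρ g m)
    (ℱ : Filtration ℝ≥0 mΩ) (X : ℝ≥0 → Lp ℝ 2 μ)
    (hadapt : ∀ t, X t ∈ RobustNeutral.subL2 (ℱ t) μ)
    (hpos : ∀ t, ∀ᵐ ω ∂μ, 0 < X t ω) :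
    (∀ (Y : Lp ℝ 2 μ) (κ : ℝ), P.IsMultiplier g m 0 Y κ →
      ∃ η : ℝ, 0 < η ∧ κ = 2 * η ∧ ∃ Z₀ : Lp ℝ 2 μ,
        P.conditioning 0 Y = {Z₀} ∧
        RobustNeutral.arginf P.L2G (fun Z => ((1 / 2 * ‖Y - Z‖ ^ 2 : ℝ) : EReal) +
          (η : EReal) * RobustNeutral.aggRisk P.ρ g Z) = {Z₀} ∧
        RobustNeutral.prox (fun Z => (η : EReal) * RobustNeutral.aggRisk P.ρ g Z +
          RobustNeutral.indicatorFn P.L2G Z) Y = {Z₀}) ∧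
    (∀ t : ℝ≥0, P.𝒢 ≤ ℱ t → ∀ κ : ℝ, P.IsMultiplier g m 0 (X t) κ →
      ∃ η : ℝ, 0 < η ∧ κ = 2 * η ∧ ∃ D : Lp ℝ 2 μ,
        RobustNeutral.HasGateauxGradient
          (RobustNeutral.robustValue (ℱ t) (P.lagrangePenalty g η)) (X t) D ∧
        P.conditioning 0 (X t) = {X t - η • D}) ∧
    (∀ t : ℝ≥0, P.𝒢 ≤ ℱ t → ∃ D : Lp ℝ 2 μ,
        RobustNeutral.HasGateauxGradient
          (RobustNeutral.robustValue (ℱ t) (P.penalty 0)) (X t) D ∧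
        P.conditioning 0 (X t) = {X t - (1 / 2 : ℝ) • D}) := by
  have hbot : ∀ Z, RobustNeutral.aggRisk P.ρ g Z ≠ ⊥ :=
    RobustNeutral.aggRisk_ne_bot P.risk.proper.1 g
  have hreal : ∀ Z ∈ P.L2G ∩ P.Φ, ∃ r : ℝ, RobustNeutral.aggRisk P.ρ g Z = r := fun Z hZ => by
    have h2 := hZ.2
    rw [hΦ] at h2
    exact ⟨_, (EReal.coe_toReal (ne_top_of_le_ne_top (EReal.coe_ne_top m) h2) (hbot Z)).symm⟩
  refine ⟨fun Y κ hκ => ?_, fun t ht κ hκ => ?_, fun t ht => ?_⟩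
  · obtain ⟨Z₀, hZ₀, -, hcond⟩ := P.exists_conditioning_zero_eq Y
    obtain ⟨r, hr⟩ := hreal Z₀ hZ₀
    have hη : 0 < κ / 2 := half_pos hκ.1
    have hhalf : RobustNeutral.arginf P.L2G (fun Z => ((1 / 2 * ‖Y - Z‖ ^ 2 : ℝ) : EReal) +
        ((κ / 2 : ℝ) : EReal) * RobustNeutral.aggRisk P.ρ g Z) = {Z₀} := by
      rw [← hcond, hκ.conditioning_eq hΦ]
      exact RobustNeutral.arginf_half _ _ hκ.1 hbot
    have hne_bot : ∀ Z, ((1 / 2 * ‖Y - Z‖ ^ 2 : ℝ) : EReal) +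
        ((κ / 2 : ℝ) : EReal) * RobustNeutral.aggRisk P.ρ g Z ≠ ⊥ := fun Z => by
      rcases eq_or_ne (RobustNeutral.aggRisk P.ρ g Z) ⊤ with h | h
      · rw [h, EReal.coe_mul_top_of_pos hη, EReal.coe_add_top]
        exact top_ne_bot
      · rw [← EReal.coe_toReal h (hbot Z), ← EReal.coe_mul, ← EReal.coe_add]
        exact EReal.coe_ne_bot _
    refine ⟨κ / 2, hη, by ring, Z₀, hcond, hhalf, ?_⟩
    rw [← hhalf, ← RobustNeutral.arginf_univ_add_indicatorFn hne_bot ⟨Z₀, hZ₀.1, ?_⟩]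
    · simp only [RobustNeutral.prox, add_assoc]
    · rw [hr, ← EReal.coe_mul, ← EReal.coe_add]
      exact EReal.coe_ne_top _
  · obtain ⟨Z₀, hZ₀, -, hcond⟩ := P.exists_conditioning_zero_eq (X t)
    obtain ⟨r, hr⟩ := hreal Z₀ hZ₀
    obtain ⟨η, rfl⟩ : ∃ η : ℝ, κ = 2 * η := ⟨κ / 2, by ring⟩
    have hη : 0 < η := by linarith [hκ.1]
    have hXt : X t = Z₀ + η • (η⁻¹ • (X t - Z₀)) := by
      rw [smul_inv_smul₀ hη.ne', add_sub_cancel]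
    have hmin : Z₀ ∈ P.conditioning 0 (X t) := hcond ▸ rfl
    rw [hκ.conditioning_eq hΦ] at hmin
    have hsub := RobustNeutral.subgradient_of_isMin hconv hbot
      (RobustNeutral.subL2 P.𝒢 μ).convex hη hZ₀.1 hXt hr hmin.2
    refine ⟨η, hη, rfl, η⁻¹ • (X t - Z₀), RobustNeutral.hasGateauxGradient_robustValue hη hXt
      (Submodule.smul_mem _ _ (Submodule.sub_mem _ (hadapt t) (RobustNeutral.subL2_mono ht hZ₀.1)))
      (r := r) ?_ fun Y => ?_, ?_⟩
    · simp [RobustNeutral.indicatorFn, hZ₀.1, hr]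
    -- Optimality gives the subgradient inequality only on `L²(𝒢)`; the indicator makes it trivial
    -- elsewhere.
    · by_cases hY : Y ∈ P.L2G
      · simpa [RobustNeutral.indicatorFn, hY] using hsub Y hY
      · simp only [RobustNeutral.indicatorFn, hY, if_false]
        rw [EReal.add_top_of_ne_bot (hbot Y)]
        exact le_top
    · rw [hcond, smul_inv_smul₀ hη.ne', sub_sub_cancel]
  · obtain ⟨Z₀, hZ₀, hproj, hcond⟩ := P.exists_conditioning_zero_eq (X t)
    -- With `η = 1/2` the quadratic `‖·‖²/(2η)` is the loss `‖·‖²` itself, hence the factor `2` in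
    -- the gradient.
    have hXt : X t = Z₀ + (1 / 2 : ℝ) • ((2 : ℝ) • (X t - Z₀)) := by
      module
    refine ⟨(2 : ℝ) • (X t - Z₀), ?_, ?_⟩
    · have hgrad := RobustNeutral.hasGateauxGradient_robustValue
        (f := RobustNeutral.indicatorFn (P.L2G ∩ P.Φ)) one_half_pos hXt
        (Submodule.smul_mem _ _ (Submodule.sub_mem _ (hadapt t) (RobustNeutral.subL2_mono ht hZ₀.1)))
        (r := 0) (by simp [RobustNeutral.indicatorFn, hZ₀]) fun Y => ?_
      · convert hgrad using 3 with Z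
        rw [RobustNeutral.RiskPerspective.penalty, RobustNeutral.conjugate_indicatorFn]
        congr 2
        funext Y
        rw [P.loss_zero]
        norm_num
      · by_cases hY : Y ∈ P.L2G ∩ P.Φ
        · have h := hproj Y hY
          simp only [RobustNeutral.indicatorFn, hY, if_true]
          rw [← EReal.coe_zero, EReal.coe_le_coe_iff, inner_smul_left]
          simp only [conj_trivial]
          linarith
        · simp only [RobustNeutral.indicatorFn, hY, if_false, le_top]
    · rw [hcond]
      congr 1
      module
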